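/- Let $p$ be a prime and let $R$ be a reduced Noetherian ring of characteristic $p$ that is $F$-finite (the Frobenius makes $R$ a finite $R$-module). For $e\ge 0$ let $F^e_*R$ be $R$ viewed as an $R$-module via the $e$-th iterate of Frobenius, and let $\mathcal C(R)=\bigoplus_{e\ge 0}\operatorname{Hom}_R(F^e_*R,R)$, a graded ring with product $\phi\cdot\psi=\phi\circ F^d_*\psi$ for $\phi$ homogeneous of degree $d$. Let $R^\circ$ be the set of elements of $R$ lying in no minimal prime of $R$. A triple $(R,\mathcal T,\mathfrak a^t)$ consists of $R$, a graded subalgebra $\mathcal T\subseteq\mathcal C(R)$ with $\mathcal T_0=\mathcal C(R)_0\cong R$, an ideal $\mathfrak a\subseteq R$ and a real number $t>0$. It is *non-degenerate* if $\mathfrak a\cap R^\circ\ne\emptyset$ and, for some $e>0$, there is $\phi\in\mathcal T_e$ whose image in $\operatorname{Hom}_{R_\eta}(F^e_*R_\eta,R_\eta)$ is nonzero for every minimal prime $\eta$ of $R$. The *big test ideal* $\tau_b(R;\mathcal T,\mathfrak a^t)$ is, if it exists, the smallest ideal $J\subseteq R$ such that $J\cap R^\circ\neq\emptyset$ and $\phi\bigl(F^e_*(\mathfrak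 a^{\lceil t(p^e-1)\rceil}J)\bigr)\subseteq J$ for all $e\ge 0$ and all $\phi\in\mathcal T_e$. The triple is *strongly $F$-regular* if for every $d\in R^\circ$ there are $e\ge 0$ and $\phi\in\mathcal T_e\cdot\bigl(F^e_*\mathfrak a^{\lceil t(p^e-1)\rceil}\bigr)$ (finite sums of maps $x\mapsto\psi(bx)$ with $\psi\in\mathcal T_e$, $b\in\mathfrak a^{\lceil t(p^e-1)\rceil}$) with $1\in\phi(F^e_*(dR))$. For a multiplicative set $W\subseteq R$, $W^{-1}\mathcal T\subseteq\mathcal C(W^{-1}R)$ is the graded subalgebra whose degree $e$ piece is $\{\tfrac1w\,W^{-1}\phi : \phi\in\mathcal T_e,\ w\in W\}$. **Proposition.** Suppose that $(R,\mathcal T,\mathfrak a^t)$ is a non-degenerate triple, and that $\mathcal T'\subseteq\mathcal T$ is a graded subalgebra (with $\mathcal T'_0=\mathcal C(R)_0$) such that the triple $(R,\mathcal T',\mathfrak a^t)$ is also non-degenerate. Then all the big test ideals below exist, and: (i) $\tau_b(R;\mathcal T,\mathfrak a^t)\supseteq\tau_b(R;\mathcal T',\mathfrak a^t)$. (ii)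 For any multiplicative set $W\subseteq R$, $\;W^{-1}\tau_b(R;\mathcal T,\mathfrak a^t)=\tau_b\bigl(W^{-1}R;W^{-1}\mathcal T,(W^{-1}\mathfrak a)^t\bigr)$. (iii) $(R,\mathcal T,\mathfrak a^t)$ is strongly $F$-regular if and only if $\tau_b(R;\mathcal T,\mathfrak a^t)=R$. -/

import Mathlib

open scoped DirectSum

namespace CartierTest

section End

variable {M : Type*} [AddCommGroup M]

theorem end_add_apply (φ ψ : AddMonoid.End M) (x : M) : (φ + ψ) x = φ x + ψ x := rfl

theorem end_neg_apply (φ : AddMonoid.End M) (x : M) : (-φ) x = -φ x := rfl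

theorem end_mul_apply (φ ψ : AddMonoid.End M) (x : M) : (φ * ψ) x = φ (ψ x) := rfl

theorem end_mulLeft_apply {R : Type*} [CommRing R] (r x : R) :
    AddMonoid.End.mulLeft r x = r * x := rfl

end End

section Algebra

variable (p : ℕ) (R : Type*) [CommRing R]

/-- `Hom_R(F^e_* R, R)`. As an abelian group `F^e_* R` is `R`, and `r : R` acts on it as
multiplication by `r ^ (p ^ e)`; so an `R`-linear map `F^e_* R → R` is an additive map `φ : R → R`
with `φ (r ^ (p ^ e) * x) = r * φ x`. -/
def cartierPiece (e : ℕ) : AddSubgroup (AddMonoid.End R) where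
  carrier := {φ | ∀ r x : R, φ (r ^ (p ^ e) * x) = r * φ x}
  zero_mem' := fun r x => by simp
  add_mem' := fun {φ ψ} hφ hψ r x => by
    rw [end_add_apply, end_add_apply, hφ r x, hψ r x, mul_add]
  neg_mem' := fun {φ} hφ r x => by
    rw [end_neg_apply, end_neg_apply, hφ r x, mul_neg]

variable {p R}

theorem mem_cartierPiece {e : ℕ} {φ : AddMonoid.End R} :
    φ ∈ cartierPiece p R e ↔ ∀ r x : R, φ (r ^ (p ^ e) * x) = r * φ x := Iff.rfl

theorem cartierPiece_mul_mem {d e : ℕ} {φ ψ : AddMonoid.End R}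
    (hφ : φ ∈ cartierPiece p R d) (hψ : ψ ∈ cartierPiece p R e) :
    φ * ψ ∈ cartierPiece p R (d + e) := fun r x => by
  rw [end_mul_apply, end_mul_apply, pow_add, pow_mul, hψ, hφ]

theorem mulLeft_mem_cartierPiece (r : R) :
    (AddMonoid.End.mulLeft r : AddMonoid.End R) ∈ cartierPiece p R 0 := fun s x => by
  simp only [pow_zero, pow_one, end_mulLeft_apply]
  rw [mul_left_comm]

/-- The product of `φ` (degree `d`) and `ψ` (degree `e`) is `φ ∘ F^d_* ψ`, that is, the
composite of the underlying additive maps. -/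
instance cartierPiece_gradedMonoid : SetLike.GradedMonoid (cartierPiece p R) where
  one_mem := fun r x => by simp
  mul_mem := fun _ _ _ _ hφ hψ => cartierPiece_mul_mem hφ hψ

variable (p R)

/-- The noncommutative graded ring `𝒞(R) = ⨁_{e ≥ 0} Hom_R(F^e_* R, R)`. -/
abbrev CartierAlgebra : Type _ := ⨁ e : ℕ, cartierPiece p R e

noncomputable instance : Ring (CartierAlgebra p R) := inferInstance

/-- A graded subalgebra `𝒯 ⊆ 𝒞(R)` with `𝒯_0 = 𝒞(R)_0 = Hom_R(R, R)`, given by its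
homogeneous pieces `𝒯_e ⊆ 𝒞(R)_e`. -/
structure GradedSubalgebra where
  piece : ℕ → AddSubgroup (AddMonoid.End R)
  piece_le : ∀ e, piece e ≤ cartierPiece p R e
  piece_zero : piece 0 = cartierPiece p R 0
  mul_mem : ∀ {d e : ℕ} {φ ψ : AddMonoid.End R},
    φ ∈ piece d → ψ ∈ piece e → φ * ψ ∈ piece (d + e)

/-- Containment of graded subalgebras. -/
instance : LE (GradedSubalgebra p R) where
  le T' T := ∀ e, T'.piece e ≤ T.piece e

/-- `R°`: the elements of `R` that lie in no minimal prime of `R`. -/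
def circ : Set R := {d | ∀ η ∈ minimalPrimes R, d ∉ η}

end Algebra

theorem GradedSubalgebra.mulLeft_mul_mem {p : ℕ} {R : Type*} [CommRing R]
    (T : GradedSubalgebra p R) {e : ℕ} {φ : AddMonoid.End R}
    (hφ : φ ∈ T.piece e) (r : R) :
    (AddMonoid.End.mulLeft r : AddMonoid.End R) * φ ∈ T.piece e := by
  have h0 : (AddMonoid.End.mulLeft r : AddMonoid.End R) ∈ T.piece 0 := by
    rw [T.piece_zero]
    exact mulLeft_mem_cartierPiece r
  simpa using T.mul_mem h0 hφ

section Localize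

variable {p : ℕ} [hp : Fact p.Prime] {R : Type*} [CommRing R]
variable (W : Submonoid R) (S : Type*) [CommRing S] [Algebra R S] [IsLocalization W S]

/-- The function underlying the localization of `φ`:
`x / s = s ^ (p ^ e - 1) x / s ^ (p ^ e)` is sent to `φ (s ^ (p ^ e - 1) x) / s`. -/
noncomputable def localizeFun (p e : ℕ) (φ : R → R) (z : S) : S :=
  IsLocalization.mk' S
    (φ (((IsLocalization.sec W z).2 : R) ^ (p ^ e - 1) * (IsLocalization.sec W z).1))
    (IsLocalization.sec W z).2

theorem localizeFun_spec {e : ℕ} {φ : AddMonoid.End R} (hφ : φ ∈ cartierPiece p R e)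
    (z : S) (x : R) (s : W)
    (h : z * algebraMap R S ((s : R) ^ (p ^ e)) = algebraMap R S x) :
    algebraMap R S s * localizeFun W S p e φ z = algebraMap R S (φ x) := by
  have hq : p ^ e ≠ 0 := pow_ne_zero _ hp.out.ne_zero
  set a := (IsLocalization.sec W z).1 with ha
  set b := (IsLocalization.sec W z).2 with hb
  have hz : z * algebraMap R S (b : R) = algebraMap R S a := IsLocalization.sec_spec W z
  have key : algebraMap R S (x * (b : R) ^ (p ^ e)) =
      algebraMap R S ((b : R) ^ (p ^ e - 1) * a * (s : R) ^ (p ^ e)) := by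
    rw [map_mul, ← h, map_mul, map_mul, ← hz]
    have : (b : R) ^ (p ^ e) = (b : R) ^ (p ^ e - 1) * b := by
      rw [← pow_succ, Nat.sub_add_cancel (Nat.one_le_iff_ne_zero.mpr hq)]
    rw [this, map_mul]
    ring
  obtain ⟨w, hw⟩ := (IsLocalization.eq_iff_exists W S).mp key
  have hw' : ((w * b : R)) ^ (p ^ e) * x =
      ((w * s : R)) ^ (p ^ e) * ((b : R) ^ (p ^ e - 1) * a) := by
    have hww : (w : R) ^ (p ^ e) = (w : R) ^ (p ^ e - 1) * w := by
      rw [← pow_succ, Nat.sub_add_cancel (Nat.one_le_iff_ne_zero.mpr hq)]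
    rw [mul_pow, mul_pow, hww]
    linear_combination (w : R) ^ (p ^ e - 1) * hw
  have h2 := congrArg φ hw'
  rw [hφ, hφ] at h2
  have h3 := congrArg (algebraMap R S) h2
  simp only [map_mul] at h3
  have uw : IsUnit (algebraMap R S (w : R)) := IsLocalization.map_units S w
  have ub : IsUnit (algebraMap R S (b : R)) := IsLocalization.map_units S b
  have hval : algebraMap R S (b : R) * localizeFun W S p e φ z =
      algebraMap R S (φ ((b : R) ^ (p ^ e - 1) * a)) := by
    rw [mul_comm]
    exact IsLocalization.mk'_spec S _ _
  apply (uw.mul ub).mul_left_cancel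
  rw [h3, ← hval]
  ring

theorem localizeFun_exists (q : ℕ) (hq : q ≠ 0) (z : S) :
    ∃ (x : R) (s : W), z * algebraMap R S ((s : R) ^ q) = algebraMap R S x := by
  obtain ⟨⟨a, b⟩, h⟩ := IsLocalization.surj W z
  refine ⟨a * (b : R) ^ (q - 1), b, ?_⟩
  have : (b : R) ^ q = b * (b : R) ^ (q - 1) := by
    rw [← pow_succ', Nat.sub_add_cancel (Nat.one_le_iff_ne_zero.mpr hq)]
  rw [this, map_mul, ← mul_assoc, h, map_mul]

/-- The image of `φ ∈ Hom_R(F^e_* R, R)` under localization at `W`, as an additive map. -/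
noncomputable def localizeEnd {e : ℕ} (φ : AddMonoid.End R) (hφ : φ ∈ cartierPiece p R e) :
    AddMonoid.End S :=
  AddMonoidHom.mk' (localizeFun W S p e φ) fun y z => by
    have hq : p ^ e ≠ 0 := pow_ne_zero _ hp.out.ne_zero
    obtain ⟨a, s, hy⟩ := localizeFun_exists W S (p ^ e) hq y
    obtain ⟨b, t, hz⟩ := localizeFun_exists W S (p ^ e) hq z
    have e1 := localizeFun_spec W S hφ y _ s hy
    have e2 := localizeFun_spec W S hφ z _ t hz
    have e3 := localizeFun_spec W S hφ (y + z)
      ((t : R) ^ (p ^ e) * a + (s : R) ^ (p ^ e) * b) (s * t) (by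
        simp only [Submonoid.coe_mul, mul_pow, map_mul, map_add]
        rw [← hy, ← hz]
        ring)
    rw [map_add, hφ, hφ] at e3
    simp only [Submonoid.coe_mul, map_mul, map_add] at e3
    have us : IsUnit (algebraMap R S (s : R)) := IsLocalization.map_units S s
    have ut : IsUnit (algebraMap R S (t : R)) := IsLocalization.map_units S t
    apply (us.mul ut).mul_left_cancel
    rw [e3, ← e1, ← e2]
    ring

theorem localizeEnd_spec {e : ℕ} {φ : AddMonoid.End R} (hφ : φ ∈ cartierPiece p R e)
    (z : S) (x : R) (s : W)
    (h : z * algebraMap R S ((s : R) ^ (p ^ e)) = algebraMap R S x) :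
    algebraMap R S s * localizeEnd W S φ hφ z = algebraMap R S (φ x) :=
  localizeFun_spec W S hφ z x s h

/-- The localization of `φ` extends `φ`. -/
theorem localizeEnd_algebraMap {e : ℕ} {φ : AddMonoid.End R} (hφ : φ ∈ cartierPiece p R e)
    (x : R) : localizeEnd W S φ hφ (algebraMap R S x) = algebraMap R S (φ x) := by
  simpa using localizeEnd_spec W S hφ (algebraMap R S x) x 1 (by simp)

/-- The localization of `φ` lies in `Hom_{W⁻¹R}(F^e_* W⁻¹R, W⁻¹R)`. -/
theorem localizeEnd_mem {e : ℕ} {φ : AddMonoid.End R} (hφ : φ ∈ cartierPiece p R e) :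
    localizeEnd W S φ hφ ∈ cartierPiece p S e := fun r z => by
  have hq : p ^ e ≠ 0 := pow_ne_zero _ hp.out.ne_zero
  obtain ⟨⟨a, s⟩, hr⟩ := IsLocalization.surj W r
  obtain ⟨b, t, hz⟩ := localizeFun_exists W S (p ^ e) hq z
  simp only at hr
  have e2 := localizeEnd_spec W S hφ z _ t hz
  have e3 := localizeEnd_spec W S hφ (r ^ (p ^ e) * z) (a ^ (p ^ e) * b) (s * t) (by
    simp only [Submonoid.coe_mul, mul_pow, map_mul, map_pow]
    rw [← hz, ← hr]
    simp only [map_pow]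
    ring)
  rw [hφ] at e3
  simp only [Submonoid.coe_mul, map_mul] at e3
  have us : IsUnit (algebraMap R S (s : R)) := IsLocalization.map_units S s
  have ut : IsUnit (algebraMap R S (t : R)) := IsLocalization.map_units S t
  apply (us.mul ut).mul_left_cancel
  rw [e3, ← e2, ← hr]
  ring

/-- A map in `Hom_S(F^e_* S, S)`, `S = W⁻¹R`, is determined by its values on `R`. -/
theorem cartierPiece_ext_of_localization {p : ℕ} [hp : Fact p.Prime] {R : Type*} [CommRing R]
    (W : Submonoid R) (S : Type*) [CommRing S] [Algebra R S] [IsLocalization W S] {e : ℕ} {φ ψ : AddMonoid.End S}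
    (hφ : φ ∈ cartierPiece p S e) (hψ : ψ ∈ cartierPiece p S e)
    (h : ∀ x : R, φ (algebraMap R S x) = ψ (algebraMap R S x)) : φ = ψ := by
  have hq : p ^ e ≠ 0 := pow_ne_zero _ hp.out.ne_zero
  refine AddMonoidHom.ext fun z => ?_
  obtain ⟨b, t, hz⟩ := localizeFun_exists W S (p ^ e) hq z
  have h1 := h b
  rw [← hz, map_pow, mul_comm z, hφ, hψ] at h1
  exact (IsLocalization.map_units S t).mul_left_cancel h1

theorem eq_mk_mul_localizeEnd_iff {e : ℕ} {φ : AddMonoid.End R} (hφ : φ ∈ cartierPiece p R e)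
    (w : W) (ψ : AddMonoid.End S) :
    (∀ z : S, ψ z = IsLocalization.mk' S 1 w * localizeEnd W S φ hφ z) ↔
      ψ ∈ cartierPiece p S e ∧
        ∀ x : R, algebraMap R S w * ψ (algebraMap R S x) = algebraMap R S (φ x) := by
  have hw : algebraMap R S w * IsLocalization.mk' S 1 w = 1 := by
    rw [mul_comm, IsLocalization.mk'_spec, map_one]
  constructor
  · intro h
    refine ⟨fun r z => ?_, fun x => ?_⟩
    · rw [h, h, localizeEnd_mem W S hφ]
      ring
    · rw [h, localizeEnd_algebraMap, ← mul_assoc, hw, one_mul]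
  · rintro ⟨hψ, h⟩ z
    have h1 : AddMonoid.End.mulLeft (algebraMap R S w) * ψ =
        localizeEnd W S φ hφ := by
      refine cartierPiece_ext_of_localization W S (p := p) (e := e)
        (fun r z => ?_) (localizeEnd_mem W S hφ) fun x => ?_
      · rw [end_mul_apply, end_mul_apply, hψ]
        simp only [end_mulLeft_apply]
        ring
      · rw [end_mul_apply, localizeEnd_algebraMap, ← h]
        rw [end_mulLeft_apply]
    rw [← h1, end_mul_apply, end_mulLeft_apply, ← mul_assoc,
      mul_comm (IsLocalization.mk' S 1 w), hw, one_mul]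

/-- `W⁻¹𝒯`: its degree `e` piece `W⁻¹(𝒯_e)` consists of the maps `(1 / w) · W⁻¹φ` with
`φ ∈ 𝒯_e` and `w ∈ W`. -/
noncomputable def GradedSubalgebra.localize (T : GradedSubalgebra p R) :
    GradedSubalgebra p S where
  piece e :=
    { carrier := {ψ | ∃ (φ : AddMonoid.End R) (hφ : φ ∈ T.piece e) (w : W), ∀ z : S,
        ψ z = IsLocalization.mk' S 1 w * localizeEnd W S φ (T.piece_le e hφ) z}
      zero_mem' := ⟨0, zero_mem _, 1, (eq_mk_mul_localizeEnd_iff W S _ _ _).mpr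
        ⟨zero_mem _, fun x => by simp⟩⟩
      add_mem' := by
        rintro ψ₁ ψ₂ ⟨φ₁, h₁, w₁, e₁⟩ ⟨φ₂, h₂, w₂, e₂⟩
        obtain ⟨c₁, e₁⟩ := (eq_mk_mul_localizeEnd_iff W S _ _ _).mp e₁
        obtain ⟨c₂, e₂⟩ := (eq_mk_mul_localizeEnd_iff W S _ _ _).mp e₂
        refine ⟨_, add_mem (T.mulLeft_mul_mem h₁ (w₂ : R)) (T.mulLeft_mul_mem h₂ (w₁ : R)),
          w₁ * w₂, (eq_mk_mul_localizeEnd_iff W S _ _ _).mpr ⟨add_mem c₁ c₂, fun x => ?_⟩⟩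
        simp only [end_add_apply, end_mul_apply, end_mulLeft_apply,
          Submonoid.coe_mul, map_mul, map_add]
        rw [← e₁, ← e₂]
        ring
      neg_mem' := by
        rintro ψ ⟨φ, h, w, e⟩
        obtain ⟨c, e⟩ := (eq_mk_mul_localizeEnd_iff W S _ _ _).mp e
        refine ⟨-φ, neg_mem h, w, (eq_mk_mul_localizeEnd_iff W S _ _ _).mpr
          ⟨neg_mem c, fun x => ?_⟩⟩
        rw [end_neg_apply, end_neg_apply, map_neg, ← e, mul_neg] }
  piece_le := by
    rintro e ψ ⟨φ, h, w, e⟩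
    exact ((eq_mk_mul_localizeEnd_iff W S _ _ _).mp e).1
  piece_zero := by
    refine le_antisymm ?_ ?_
    · rintro ψ ⟨φ, h, w, e⟩
      exact ((eq_mk_mul_localizeEnd_iff W S _ _ _).mp e).1
    · intro ψ hψ
      obtain ⟨⟨a, s⟩, h⟩ := IsLocalization.surj W (ψ 1)
      refine ⟨AddMonoid.End.mulLeft a, by rw [T.piece_zero]; exact mulLeft_mem_cartierPiece a, s,
        (eq_mk_mul_localizeEnd_iff W S _ _ _).mpr ⟨hψ, fun x => ?_⟩⟩
      have h1 := hψ (algebraMap R S x) 1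
      rw [pow_zero, pow_one, mul_one] at h1
      simp only at h
      rw [h1, end_mulLeft_apply, map_mul, ← h]
      ring
  mul_mem := by
    rintro d e ψ₁ ψ₂ ⟨φ₁, h₁, w₁, e₁⟩ ⟨φ₂, h₂, w₂, e₂⟩
    obtain ⟨c₁, e₁⟩ := (eq_mk_mul_localizeEnd_iff W S _ _ _).mp e₁
    obtain ⟨c₂, e₂⟩ := (eq_mk_mul_localizeEnd_iff W S _ _ _).mp e₂
    refine ⟨_, T.mul_mem h₁ (T.mulLeft_mul_mem h₂ ((w₂ : R) ^ (p ^ d - 1))), w₁ * w₂,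
      (eq_mk_mul_localizeEnd_iff W S _ _ _).mpr ⟨cartierPiece_mul_mem c₁ c₂, fun x => ?_⟩⟩
    have hq : p ^ d ≠ 0 := pow_ne_zero _ hp.out.ne_zero
    have hw : (algebraMap R S w₂) ^ (p ^ d) =
        (algebraMap R S w₂) ^ (p ^ d - 1) * algebraMap R S w₂ := by
      rw [← pow_succ, Nat.sub_add_cancel (Nat.one_le_iff_ne_zero.mpr hq)]
    simp only [end_mul_apply, end_mulLeft_apply, Submonoid.coe_mul, map_mul]
    rw [← e₁, map_mul, map_pow, ← e₂, ← mul_assoc, ← hw, c₁]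
    ring

end Localize

section TestIdeal

variable {p : ℕ} {R : Type*} [CommRing R]

/-- `φ ∈ Hom_R(F^e_* R, R)` is non-degenerate if its image in `Hom_{R_η}(F^e_* R_η, R_η)` is
nonzero for every minimal prime `η`. -/
def IsNondegenerateMap [Fact p.Prime] {e : ℕ} (φ : AddMonoid.End R)
    (hφ : φ ∈ cartierPiece p R e) : Prop :=
  ∀ (η : Ideal R) [η.IsPrime], η ∈ minimalPrimes R →
    localizeEnd η.primeCompl (Localization.AtPrime η) φ hφ ≠ 0

/-- The triple `(R, 𝒯, 𝔞^t)` is non-degenerate: some `𝒯_e` with `e > 0` contains a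
non-degenerate element, and `𝔞` meets `R°`. -/
def IsNondegenerate [Fact p.Prime] (T : GradedSubalgebra p R) (a : Ideal R) : Prop :=
  (∃ (e : ℕ) (_ : 0 < e) (φ : AddMonoid.End R) (hφ : φ ∈ T.piece e),
    IsNondegenerateMap φ (T.piece_le e hφ)) ∧ ((a : Set R) ∩ circ R).Nonempty

/-- The ideal `𝔞 ^ ⌈t (p ^ e - 1)⌉`. -/
noncomputable def ceilPow (p : ℕ) (a : Ideal R) (t : ℝ) (e : ℕ) : Ideal R :=
  a ^ ⌈t * ((p : ℝ) ^ e - 1)⌉₊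

/-- `𝒯_e · (F^e_* 𝔟)`: the finite sums of the maps `x ↦ φ (b x)` with `φ ∈ 𝒯_e`, `b ∈ 𝔟`. -/
def GradedSubalgebra.pieceMul (T : GradedSubalgebra p R) (e : ℕ) (b : Ideal R) :
    AddSubgroup (AddMonoid.End R) :=
  AddSubgroup.closure {ψ | ∃ φ ∈ T.piece e, ∃ r ∈ b, ψ = φ * AddMonoid.End.mulLeft r}

/-- `J` is uniformly `(𝒯, 𝔞^t, F)`-compatible: `φ (F^e_* 𝔞^⌈t(p^e-1)⌉ J) ⊆ J` for all `e ≥ 0`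
and `φ ∈ 𝒯_e`. -/
def IsCompatible (T : GradedSubalgebra p R) (a : Ideal R) (t : ℝ) (J : Ideal R) : Prop :=
  ∀ (e : ℕ), ∀ φ ∈ T.piece e, ∀ x ∈ ceilPow p a t e * J, φ x ∈ J

/-- The ideals among which the big test ideal is the smallest. -/
def testIdealCandidates (T : GradedSubalgebra p R) (a : Ideal R) (t : ℝ) : Set (Ideal R) :=
  {J | IsCompatible T a t J ∧ ((J : Set R) ∩ circ R).Nonempty}

/-- The big test ideal `τ_b(R; 𝒯, 𝔞^t)`. The infimum is the smallest candidate whenever a smallest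
candidate exists; `IsBigTestIdeal` asserts that an ideal is the smallest candidate. -/
noncomputable def bigTestIdeal (T : GradedSubalgebra p R) (a : Ideal R) (t : ℝ) : Ideal R :=
  sInf (testIdealCandidates T a t)

/-- `J` is the smallest uniformly `(𝒯, 𝔞^t, F)`-compatible ideal that meets `R°`. -/
def IsBigTestIdeal (T : GradedSubalgebra p R) (a : Ideal R) (t : ℝ) (J : Ideal R) : Prop :=
  IsLeast (testIdealCandidates T a t) J

/-- The triple is strongly `F`-regular: for every `d ∈ R°` there are `e` and
`φ ∈ 𝒯_e · (F^e_* 𝔞^⌈t(p^e-1)⌉)` with `1 ∈ φ (F^e_* (dR))`. -/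
def IsStronglyFRegular (T : GradedSubalgebra p R) (a : Ideal R) (t : ℝ) : Prop :=
  ∀ d ∈ circ R, ∃ e : ℕ, ∃ φ ∈ T.pieceMul e (ceilPow p a t e),
    ∃ x ∈ Ideal.span {d}, φ x = 1

end TestIdeal

end CartierTest

namespace CartierTest

/-! ### Frobenius duality over a field. -/

section DualExpansion

/-! Existence rests on a test element: one element of `R°` lying in every candidate, so that the
intersection of the candidates is again a candidate. Put `q = p ^ e`. At a minimal prime the reduced
ring `R` localizes to a field `K`, finite over its `q`-th powers, and a nonzero `φ` gives a
nondegenerate pairing. Dual bases, clearing of denominators and prime avoidance give `c ∈ R°` with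
`c * y ∈ (φ(g y R))^[q]` for all `y`, where `g` lies in the relevant power of `𝔞`. For a candidate
`J` this yields `c J ⊆ J^[q] ⊆ J²`, whence some power of `c` lies in `J` by Cayley–Hamilton
(`exists_pow_mem_of_mul_mem_mul_self`). Applying `φ` lowers the exponent to 3, independently of `J`
(`pow_three_mem`).

For (i), a candidate for `𝒯` is one for `𝒯'`. For (ii), extension and contraction along `R → W⁻¹R`
preserve candidates, so the least one extends to the least one.

For (iii), strong `F`-regularity puts 1 in every candidate. Conversely, the sum over `e` of the
trace ideals of `dcR` is a candidate, hence is `R`. A multiplicativity property of trace ideals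
(`traceIdeal_mul_traceIdeal_top_le`) then finds a single degree whose trace ideal of `dR` is `R`. -/

theorem exists_finset_forall_eq_sum_pow_mul {p : ℕ} [Fact p.Prime] {R : Type*} [CommRing R]
    [CharP R p] (hF : (frobenius R p).Finite) (e : ℕ) :
    ∃ s : Finset R, ∀ z : R, ∃ r : R → R, z = ∑ y ∈ s, r y ^ (p ^ e) * y := by
  have h : (iterateFrobenius R p e).Finite := by
    induction e with
    | zero => rw [iterateFrobenius_zero]; exact RingHom.Finite.id R
    | succ e ih => rw [iterateFrobenius_add, iterateFrobenius_one]; exact ih.comp hF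
  let : Module R R := (iterateFrobenius R p e).toAlgebra.toModule
  obtain ⟨s, hs⟩ := h.fg_top
  refine ⟨s, fun z => ?_⟩
  obtain ⟨r, -, hr⟩ := Submodule.mem_span_finset.mp (hs ▸ Submodule.mem_top : z ∈ Submodule.span R _)
  exact ⟨r, hr.symm⟩

/-- The form `ψ (x * y) ^ (p ^ e)` is bilinear over the subfield `L` of `p ^ e`-th powers. It is
nondegenerate, since a nonzero `x` is invertible and `x * K = K`. As `K` is finite over `L`, a basis
`x` has a dual family `b`. -/
theorem exists_dual_expansion {p : ℕ} [Fact p.Prime] {K : Type*} [inst : CommRing K]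
    (hK : IsField K) [CharP K p] {e : ℕ}
    {ι : Type*} (s : Finset ι) (v : ι → K)
    (hs : ∀ z : K, ∃ r : ι → K, z = ∑ y ∈ s, r y ^ (p ^ e) * v y)
    {ψ : AddMonoid.End K} (hψ : ψ ∈ cartierPiece p K e) (h0 : ψ ≠ 0) :
    ∃ (n : ℕ) (x b : Fin n → K), ∀ y, y = ∑ i, x i * ψ (b i * y) ^ (p ^ e) := by
  obtain ⟨F, rfl⟩ : ∃ F : Field K, F.toCommRing = inst := ⟨hK.toField, rfl⟩
  let L : Subfield K := (iterateFrobenius K p e).fieldRange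
  have hL : ∀ z : K, z ^ (p ^ e) ∈ L := fun z => ⟨z, iterateFrobenius_def p e z⟩
  have hfin : Module.Finite L K := by
    classical
    refine ⟨⟨s.image v, eq_top_iff.mpr fun z _ => ?_⟩⟩
    obtain ⟨r, hr⟩ := hs z
    rw [hr]
    exact sum_mem fun y hy => Submodule.smul_mem _ (⟨_, hL (r y)⟩ : L) (Submodule.subset_span
      (Finset.mem_coe.mpr (Finset.mem_image_of_mem v hy)))
  let B : K →ₗ[L] Module.Dual L K :=
    LinearMap.mk₂ L (fun x y => (⟨_, hL (ψ (x * y))⟩ : L))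
      (fun x x' y => Subtype.ext <| by
        change ψ ((x + x') * y) ^ p ^ e = ψ (x * y) ^ p ^ e + ψ (x' * y) ^ p ^ e
        rw [add_mul, map_add, add_pow_char_pow])
      (by
        rintro ⟨_, c, rfl⟩ x y
        refine Subtype.ext ?_
        change ψ ((iterateFrobenius K p e c * x) * y) ^ p ^ e = iterateFrobenius K p e c * ψ (x * y) ^ p ^ e
        rw [iterateFrobenius_def, mul_assoc, hψ, mul_pow])
      (fun x y y' => Subtype.ext <| by
        change ψ (x * (y + y')) ^ p ^ e = ψ (x * y) ^ p ^ e + ψ (x * y') ^ p ^ e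
        rw [mul_add, map_add, add_pow_char_pow])
      (by
        rintro ⟨_, c, rfl⟩ x y
        refine Subtype.ext ?_
        change ψ (x * (iterateFrobenius K p e c * y)) ^ p ^ e = iterateFrobenius K p e c * ψ (x * y) ^ p ^ e
        rw [iterateFrobenius_def, mul_left_comm, hψ, mul_pow])
  have hB : ∀ x y, ((B x y : L) : K) = ψ (x * y) ^ p ^ e := fun _ _ => rfl
  have hq : p ^ e ≠ 0 := pow_ne_zero _ (Fact.out : p.Prime).ne_zero
  have hinj : Function.Injective B := by
    rw [injective_iff_map_eq_zero]
    intro x hx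
    by_contra hx0
    apply h0
    refine AddMonoidHom.ext fun z => ?_
    have h1 := hB x (x⁻¹ * z)
    rw [hx, mul_inv_cancel_left₀ hx0] at h1
    exact (pow_eq_zero_iff hq).mp h1.symm
  have hsurj : Function.Surjective B :=
    (LinearMap.injective_iff_surjective_of_finrank_eq_finrank
      Subspace.dual_finrank_eq.symm).mp hinj
  let w := Module.finBasis L K
  choose b hb using fun i => hsurj (w.coord i)
  refine ⟨_, w, b, fun y => ?_⟩
  conv_lhs => rw [← w.sum_repr y]
  refine Finset.sum_congr rfl fun i _ => ?_
  rw [← hB, hb, mul_comm]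
  rfl

end DualExpansion

/-! ### Minimal primes of a reduced ring and prime avoidance. -/

section MinimalPrimes

variable {R : Type*} [CommRing R]

theorem maximalIdeal_localization_eq_bot [IsReduced R] {η : Ideal R} [η.IsPrime]
    (hη : η ∈ minimalPrimes R) :
    IsLocalRing.maximalIdeal (Localization.AtPrime η) = ⊥ := by
  have h := IsLocalization.AtPrime.radical_map_of_mem_minimalPrimes
    (A := Localization.AtPrime η) η ⊥ hη
  rw [IsLocalization.AtPrime.map_eq_maximalIdeal η (Localization.AtPrime η), Ideal.map_bot] at h
  rw [← h]
  exact nilradical_eq_zero _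

theorem exists_notMem_mul_eq_zero [IsReduced R] {η : Ideal R}
    (hη : η ∈ minimalPrimes R) {x : R} (hx : x ∈ η) : ∃ u ∉ η, u * x = 0 := by
  have := hη.1.1
  have h : algebraMap R (Localization.AtPrime η) x = 0 := by
    rw [← Ideal.mem_bot, ← maximalIdeal_localization_eq_bot hη,
      IsLocalization.AtPrime.to_map_mem_maximal_iff _ η]
    exact hx
  obtain ⟨u, hu⟩ := (IsLocalization.map_eq_zero_iff η.primeCompl _ x).mp h
  exact ⟨u, u.2, hu⟩

theorem eq_zero_of_mul_eq_zero_of_mem_circ [IsReduced R] {d x : R} (hd : d ∈ circ R)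
    (h : x * d = 0) : x = 0 := by
  have : x ∈ sInf (minimalPrimes R) := by
    refine Submodule.mem_sInf.mpr fun η hη => ?_
    exact (hη.1.1.mem_or_mem (h ▸ η.zero_mem : x * d ∈ η)).resolve_right (hd η hη)
  rw [minimalPrimes, Ideal.sInf_minimalPrimes] at this
  exact (mem_nilradical.mp this).eq_zero

theorem mul_mem_circ {c d : R} (hc : c ∈ circ R) (hd : d ∈ circ R) : c * d ∈ circ R :=
  fun η hη h => (hη.1.1.mem_or_mem h).elim (hc η hη) (hd η hη)

theorem pow_mem_circ {c : R} (hc : c ∈ circ R) (n : ℕ) : c ^ n ∈ circ R :=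
  fun η hη h => hc η hη (hη.1.1.mem_of_pow_mem n h)

theorem inter_circ_nonempty [IsNoetherianRing R] {I : Ideal R}
    (h : ∀ η ∈ minimalPrimes R, ¬ I ≤ η) : ((I : Set R) ∩ circ R).Nonempty := by
  have h1 := mt (Ideal.subset_union_prime_finite (minimalPrimes.finite_of_isNoetherianRing R)
    (f := id) ⊥ ⊥ (fun η hη _ _ => hη.1.1) (I := I)).mp (by simpa using h)
  obtain ⟨x, hx, hx'⟩ := Set.not_subset.mp h1
  exact ⟨x, hx, fun η hη hxη => hx' (Set.mem_biUnion hη hxη)⟩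

end MinimalPrimes

/-! ### Descending the dual expansion from the fields `R_η` to `R`. -/

section Expansion

variable {p : ℕ} [hp : Fact p.Prime] {R : Type*} [CommRing R]

theorem pow_eq_pow_sub_one_mul {A : Type*} [CommRing A] (w : A) (e : ℕ) :
    w ^ (p ^ e) = w ^ (p ^ e - 1) * w := by
  rw [← pow_succ, Nat.sub_add_cancel (Nat.one_le_iff_ne_zero.mpr
    (pow_ne_zero _ hp.out.ne_zero))]

theorem exists_expansion_of_isField_localization [CharP R p]
    (hF : (frobenius R p).Finite) {e : ℕ} {φ : AddMonoid.End R} (hφ : φ ∈ cartierPiece p R e)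
    {η : Ideal R} [η.IsPrime] {K : Type*} [CommRing K] [Algebra R K]
    [IsLocalization η.primeCompl K] (hK : IsField K)
    (h0 : localizeEnd η.primeCompl K φ hφ ≠ 0) :
    ∃ c ∉ η, ∃ (n : ℕ) (x b : Fin n → R), ∀ y, c * y = ∑ i, x i * φ (b i * y) ^ (p ^ e) := by
  classical
  obtain ⟨s, hs⟩ := exists_finset_forall_eq_sum_pow_mul hF e
  have := hK.nontrivial
  have hchar : CharP K p := by
    have hp0 : ((p : ℕ) : K) = 0 := by
      rw [← map_natCast (algebraMap R K), CharP.cast_eq_zero, map_zero]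
    exact (CharP.charP_iff_prime_eq_zero hp.out).mpr hp0
  obtain ⟨n, x, b, hxb⟩ := exists_dual_expansion hK s (algebraMap R K) (fun z => by
    obtain ⟨a, w, rfl⟩ := IsLocalization.exists_mk'_eq η.primeCompl z
    obtain ⟨r, hr⟩ := hs ((w : R) ^ (p ^ e - 1) * a)
    have hw : IsLocalization.mk' K 1 w * algebraMap R K w = 1 := by
      rw [IsLocalization.mk'_spec, map_one]
    refine ⟨fun y => algebraMap R K (r y) * IsLocalization.mk' K 1 w, ?_⟩
    calc IsLocalization.mk' K a w = algebraMap R K a * IsLocalization.mk' K 1 w := by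
          rw [IsLocalization.mk'_eq_mul_mk'_one]
      _ = IsLocalization.mk' K 1 w ^ (p ^ e) * algebraMap R K ((w : R) ^ (p ^ e - 1) * a) := by
          have h1 : IsLocalization.mk' K 1 w ^ (p ^ e - 1) * algebraMap R K w ^ (p ^ e - 1) = 1 := by
            rw [← mul_pow, hw, one_pow]
          rw [pow_eq_pow_sub_one_mul, map_mul, map_pow]
          linear_combination (-(IsLocalization.mk' K 1 w * algebraMap R K a)) * h1
      _ = _ := by
          conv_lhs => rw [hr]
          rw [map_sum, Finset.mul_sum]
          exact Finset.sum_congr rfl fun y _ => by rw [map_mul, map_pow]; ring) (localizeEnd_mem η.primeCompl K hφ) h0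
  obtain ⟨s₁, h₁⟩ := IsLocalization.exist_integer_multiples_of_finite η.primeCompl x
  obtain ⟨s₂, h₂⟩ := IsLocalization.exist_integer_multiples_of_finite η.primeCompl b
  choose x' hx' using h₁
  choose b' hb' using h₂
  simp only [Algebra.smul_def] at hx' hb'
  have key : ∀ y : R, algebraMap R K (s₁ * s₂ ^ (p ^ e) * y -
      ∑ i, x' i * φ (s₂ ^ (p ^ e - 1) * b' i * y) ^ (p ^ e)) = 0 := fun y => by
    -- Since `b' i = s₂ * b i` in `K`, the extra `s₂ ^ (p ^ e - 1)` completes a full `p ^ e`-th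
    -- power, which leaves `φ` as `s₂`.
    have h : ∀ i, algebraMap R K (φ (s₂ ^ (p ^ e - 1) * b' i * y)) = algebraMap R K s₂ *
        localizeEnd η.primeCompl K φ hφ (b i * algebraMap R K y) := fun i => by
      rw [← localizeEnd_algebraMap η.primeCompl K hφ, ← localizeEnd_mem η.primeCompl K hφ]
      congr 1
      rw [pow_eq_pow_sub_one_mul]
      simp only [map_mul, map_pow, hb']
      ring
    simp only [map_sub, map_sum, map_mul, map_pow, h]
    conv_lhs => enter [1]; rw [hxb (algebraMap R K y)]
    rw [Finset.mul_sum, ← Finset.sum_sub_distrib]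
    exact Finset.sum_eq_zero fun i _ => by rw [hx']; ring
  have key' : ∀ y : R, ∃ u : η.primeCompl, (u : R) * (s₁ * s₂ ^ (p ^ e) * y -
      ∑ i, x' i * φ (s₂ ^ (p ^ e - 1) * b' i * y) ^ (p ^ e)) = 0 := fun y =>
    (IsLocalization.map_eq_zero_iff η.primeCompl K _).mp (key y)
  choose u hu using key'
  -- The annihilator `u y` depends on `y`. Both sides are additive in `y` and linear over `p ^ e`-th
  -- powers, so the product over the finite generating set `s` serves for all `y`.
  refine ⟨((∏ y ∈ s, u y) * (s₁ * s₂ ^ (p ^ e)) : η.primeCompl), ((∏ y ∈ s, u y) * (s₁ * s₂ ^ (p ^ e)) : η.primeCompl).2, n,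
    fun i => (∏ y ∈ s, u y : η.primeCompl) * x' i, fun i => s₂ ^ (p ^ e - 1) * b' i,
    fun z => ?_⟩
  obtain ⟨r, hr⟩ := hs z
  have hgen : ∀ y ∈ s, ((∏ y ∈ s, u y : η.primeCompl) : R) * (s₁ * s₂ ^ (p ^ e) * y -
      ∑ i, x' i * φ (s₂ ^ (p ^ e - 1) * b' i * y) ^ (p ^ e)) = 0 := fun y hy => by
    rw [← Finset.prod_erase_mul s u hy, Submonoid.coe_mul, mul_assoc, hu, mul_zero]
  have hφr : ∀ i, φ (s₂ ^ (p ^ e - 1) * b' i * z) ^ (p ^ e) =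
      ∑ y ∈ s, r y ^ (p ^ e) * φ (s₂ ^ (p ^ e - 1) * b' i * y) ^ (p ^ e) := fun i => by
    conv_lhs => rw [hr]
    rw [Finset.mul_sum, map_sum, sum_pow_char_pow]
    refine Finset.sum_congr rfl fun y _ => ?_
    rw [mul_left_comm, hφ, mul_pow]
  have hsum : ∑ y ∈ s, r y ^ (p ^ e) * (((∏ y ∈ s, u y : η.primeCompl) : R) *
      (s₁ * s₂ ^ (p ^ e) * y - ∑ i, x' i * φ (s₂ ^ (p ^ e - 1) * b' i * y) ^ (p ^ e))) = 0 :=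
    Finset.sum_eq_zero fun y hy => by rw [hgen y hy, mul_zero]
  simp only [hφr]
  conv_lhs => rw [hr]
  rw [← sub_eq_zero, ← hsum]
  simp only [mul_sub, Finset.mul_sum, Finset.sum_sub_distrib, Submonoid.coe_mul,
    SubmonoidClass.coe_pow]
  rw [Finset.sum_comm]
  congr 1
  · exact Finset.sum_congr rfl fun y _ => by ring
  · exact Finset.sum_congr rfl fun y _ => Finset.sum_congr rfl fun i _ => by ring

/-- If `φ` is non-degenerate, then it is generically a generator of `Hom_R(F^e_* R, R)`; more
precisely, up to multiplication by some `c ∈ R°` every `y` lies in `(φ(F^e_* yR))^[p^e]`. -/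
theorem IsNondegenerateMap.exists_mul_mem_span [CharP R p] [IsReduced R] [IsNoetherianRing R]
    (hF : (frobenius R p).Finite) {e : ℕ} {φ : AddMonoid.End R} {hφ : φ ∈ cartierPiece p R e}
    (h : IsNondegenerateMap φ hφ) :
    ∃ c ∈ circ R, ∀ y, c * y ∈ Ideal.span (Set.range fun b => φ (b * y) ^ (p ^ e)) := by
  let C : Ideal R :=
    { carrier := {c | ∀ y, c * y ∈ Ideal.span (Set.range fun b => φ (b * y) ^ (p ^ e))}
      zero_mem' := fun y => by simp
      add_mem' := fun ha hb y => by rw [add_mul]; exact add_mem (ha y) (hb y)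
      smul_mem' := fun r c hc y => by
        rw [smul_eq_mul, mul_assoc]; exact Ideal.mul_mem_left _ _ (hc y) }
  obtain ⟨c, hc, hc'⟩ : ((C : Set R) ∩ circ R).Nonempty := by
    refine inter_circ_nonempty fun η hη hC => ?_
    have := hη.1.1
    obtain ⟨c, hc, n, x, b, hxb⟩ := exists_expansion_of_isField_localization hF hφ
      (IsLocalRing.isField_iff_maximalIdeal_eq.mpr (maximalIdeal_localization_eq_bot hη)) (h η hη)
    refine hc (hC fun y => ?_)
    rw [hxb]
    exact sum_mem fun i _ => Ideal.mul_mem_left _ _ (Ideal.subset_span ⟨b i, rfl⟩)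
  exact ⟨c, hc', hc⟩

end Expansion

/-! ### A power of `c`, independent of the candidate, lies in every candidate. -/

section TestElement

variable {p : ℕ} [hp : Fact p.Prime] {R : Type*} [CommRing R]

theorem IsNondegenerate.exists_mul_mem_span [CharP R p] [IsReduced R] [IsNoetherianRing R]
    (hF : (frobenius R p).Finite) {T : GradedSubalgebra p R} {a : Ideal R}
    (hT : IsNondegenerate T a) (t : ℝ) :
    ∃ e, 0 < e ∧ ∃ φ ∈ T.piece e, ∃ g ∈ ceilPow p a t e, ∃ c ∈ circ R,
      ∀ y, c * y ∈ Ideal.span (Set.range fun b => φ (g * (b * y)) ^ (p ^ e)) := by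
  obtain ⟨⟨e, he, φ, hφ, h⟩, f, hfa, hf⟩ := hT
  obtain ⟨c, hc, hcy⟩ := h.exists_mul_mem_span hF
  -- The expansion is applied to `g * y`, so `c` becomes `c * g`, still in `R°`.
  refine ⟨e, he, φ, hφ, f ^ ⌈t * ((p : ℝ) ^ e - 1)⌉₊, Ideal.pow_mem_pow hfa _,
    c * f ^ ⌈t * ((p : ℝ) ^ e - 1)⌉₊, mul_mem_circ hc (pow_mem_circ hf _), fun y => ?_⟩
  simpa only [mul_assoc, mul_left_comm] using hcy (f ^ ⌈t * ((p : ℝ) ^ e - 1)⌉₊ * y)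

/-- Cayley–Hamilton for multiplication by `c` on `J` gives a monic `P` with lower coefficients in
`J` and `P(c) J = 0`. Since `J` contains a nonzerodivisor, `P(c) = 0`. -/
theorem exists_pow_mem_of_mul_mem_mul_self [IsReduced R] [IsNoetherianRing R] {J : Ideal R}
    (hJ : ((J : Set R) ∩ circ R).Nonempty) {c : R} (h : ∀ y ∈ J, c * y ∈ J * J) :
    ∃ n : ℕ, c ^ n ∈ J := by
  obtain ⟨d, hdJ, hd⟩ := hJ
  obtain ⟨P, hP, -, hcoeff, hzero⟩ :=
    LinearMap.exists_monic_and_natDegree_eq_and_coeff_mem_pow_and_aeval_eq_zero R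
      (algebraMap R (Module.End R J) c) J (by
        rintro _ ⟨y, rfl⟩
        exact Submodule.mem_smul_top_iff J J _ |>.mpr (h y y.2))
  rw [Polynomial.aeval_algebraMap_apply] at hzero
  have h1 : P.eval c * d = 0 :=
    congrArg Subtype.val (LinearMap.congr_fun hzero ⟨d, hdJ⟩)
  have h2 := eq_zero_of_mul_eq_zero_of_mem_circ hd h1
  rw [Polynomial.eval_eq_sum_range, Finset.sum_range_succ, hP.coeff_natDegree, one_mul] at h2
  refine ⟨P.natDegree, ?_⟩
  rw [eq_neg_of_add_eq_zero_right h2]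
  refine neg_mem (sum_mem fun k hk => Ideal.mul_mem_right _ _ ?_)
  exact Ideal.pow_le_self (Nat.sub_ne_zero_of_lt (Finset.mem_range.mp hk)) (hcoeff k)

variable {e : ℕ} {φ : AddMonoid.End R} {g c : R}

/-- The values `φ (g * r)` form an ideal containing the generators of the span at `y = 1`. -/
theorem exists_apply_mul_eq (hφ : φ ∈ cartierPiece p R e)
    (h : ∀ y, c * y ∈ Ideal.span (Set.range fun b => φ (g * (b * y)) ^ (p ^ e))) :
    ∃ r, φ (g * r) = c := by
  have h1 := h 1
  rw [mul_one] at h1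
  refine Submodule.span_induction ?_ ⟨0, by simp⟩ ?_ ?_ h1
  · rintro _ ⟨b, rfl⟩
    refine ⟨(φ (g * b) ^ (p ^ e - 1)) ^ (p ^ e) * b, ?_⟩
    simp only [mul_one]
    rw [mul_left_comm, hφ, ← pow_eq_pow_sub_one_mul]
  · rintro _ _ - - ⟨x, rfl⟩ ⟨y, rfl⟩
    exact ⟨x + y, by rw [mul_add, map_add]⟩
  · rintro s _ - ⟨x, rfl⟩
    exact ⟨s ^ (p ^ e) * x, by rw [mul_left_comm, hφ, smul_eq_mul]⟩

theorem pow_three_mem [IsReduced R] [IsNoetherianRing R] (he : 0 < e)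
    (hφ : φ ∈ cartierPiece p R e)
    (h : ∀ y, c * y ∈ Ideal.span (Set.range fun b => φ (g * (b * y)) ^ (p ^ e)))
    {J : Ideal R} (hJφ : ∀ y ∈ J, φ (g * y) ∈ J) (hJ : ((J : Set R) ∩ circ R).Nonempty) :
    c ^ 3 ∈ J := by
  have hq : 2 ≤ p ^ e := hp.out.two_le.trans (Nat.le_self_pow he.ne' p)
  obtain ⟨n, hn⟩ := exists_pow_mem_of_mul_mem_mul_self hJ (c := c) fun y hy => by
    refine Ideal.span_le.mpr ?_ (h y)
    rintro _ ⟨b, rfl⟩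
    rw [← sq]
    exact Ideal.pow_le_pow_right hq (Ideal.pow_mem_pow (hJφ _ (J.mul_mem_left b hy)) _)
  obtain ⟨r, hr⟩ := exists_apply_mul_eq hφ h
  induction n using Nat.strong_induction_on with
  | _ n ih =>
    rcases le_or_gt n 3 with h3 | h3
    · exact J.mem_of_dvd (pow_dvd_pow c h3) hn
    · refine ih ((n + 1) / 2 + 1) (by omega) ?_
      have hle : n ≤ (n + 1) / 2 * p ^ e :=
        le_trans (by omega) (Nat.mul_le_mul_left ((n + 1) / 2) hq)
      have := hJφ _ (J.mul_mem_right r (J.mem_of_dvd (pow_dvd_pow c hle) hn))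
      rwa [pow_mul, mul_left_comm, hφ, hr, ← pow_succ] at this

end TestElement

/-! ### Existence and monotonicity of the test ideal. -/

section Existence

variable {p : ℕ} [hp : Fact p.Prime] {R : Type*} [CommRing R] [CharP R p] [IsReduced R]
  [IsNoetherianRing R]

/-- Existence of test elements. -/
theorem IsNondegenerate.exists_forall_mem (hF : (frobenius R p).Finite)
    {T : GradedSubalgebra p R} {a : Ideal R} (hT : IsNondegenerate T a) (t : ℝ) :
    ∃ c ∈ circ R, ∀ J ∈ testIdealCandidates T a t, c ∈ J := by
  obtain ⟨e, he, φ, hφ, g, hg, c, hc, h⟩ := hT.exists_mul_mem_span hF t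
  exact ⟨c ^ 3, pow_mem_circ hc 3, fun J hJ => pow_three_mem he (T.piece_le e hφ) h
    (fun y hy => hJ.1 e φ hφ _ (Ideal.mul_mem_mul hg hy)) hJ.2⟩

theorem isCompatible_sInf {p : ℕ} {R : Type*} [CommRing R] {T : GradedSubalgebra p R} {a : Ideal R}
    {t : ℝ} {s : Set (Ideal R)} (h : ∀ J ∈ s, IsCompatible T a t J) :
    IsCompatible T a t (sInf s) := fun e φ hφ _ hx =>
  Submodule.mem_sInf.mpr fun J hJ => h J hJ e φ hφ _ (Ideal.mul_mono_right (sInf_le hJ) hx)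

theorem IsNondegenerate.isBigTestIdeal (hF : (frobenius R p).Finite)
    {T : GradedSubalgebra p R} {a : Ideal R} (hT : IsNondegenerate T a) (t : ℝ) :
    IsBigTestIdeal T a t (bigTestIdeal T a t) := by
  obtain ⟨c, hc, h⟩ := hT.exists_forall_mem hF t
  exact ⟨⟨isCompatible_sInf fun J hJ => hJ.1, c, Submodule.mem_sInf.mpr h, hc⟩,
    fun J hJ => sInf_le hJ⟩

theorem IsBigTestIdeal.eq_bigTestIdeal {p : ℕ} {R : Type*} [CommRing R] {T : GradedSubalgebra p R}
    {a : Ideal R} {t : ℝ} {J : Ideal R} (h : IsBigTestIdeal T a t J) : bigTestIdeal T a t = J :=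
  h.isGLB.sInf_eq

theorem isCompatible_of_le {p : ℕ} {R : Type*} [CommRing R] {T T' : GradedSubalgebra p R}
    (hTT' : T' ≤ T) {a : Ideal R} {t : ℝ} {J : Ideal R} (h : IsCompatible T a t J) :
    IsCompatible T' a t J := fun e φ hφ => h e φ (hTT' e hφ)

end Existence

/-! ### Extension and contraction of candidates. -/

section Localization

theorem ceilPow_map {p : ℕ} {R S : Type*} [CommRing R] [CommRing S] (f : R →+* S) {a : Ideal R}
    {t : ℝ} (e : ℕ) : ceilPow p (a.map f) t e = (ceilPow p a t e).map f :=
  (Ideal.map_pow _ _ _).symm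

variable {p : ℕ} [hp : Fact p.Prime] {R : Type*} [CommRing R] {W : Submonoid R} {S : Type*}
  [CommRing S] [Algebra R S] [IsLocalization W S] {T : GradedSubalgebra p R} {a : Ideal R} {t : ℝ}

theorem mem_minimalPrimes_localization_iff {R : Type*} [CommRing R] (W : Submonoid R) {S : Type*}
    [CommRing S] [Algebra R S] [IsLocalization W S] {η : Ideal S} :
    η ∈ minimalPrimes S ↔ η.comap (algebraMap R S) ∈ minimalPrimes R := by
  have h := IsLocalization.minimalPrimes_map W S (⊥ : Ideal R)
  rw [Ideal.map_bot] at h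
  exact Set.ext_iff.mp h η

theorem localizeEnd_mem_localize {e : ℕ} {φ : AddMonoid.End R} (hφ : φ ∈ T.piece e) :
    localizeEnd W S φ (T.piece_le e hφ) ∈ (T.localize W S).piece e :=
  ⟨φ, hφ, 1, fun z => by rw [IsLocalization.mk'_one, map_one, one_mul]⟩

theorem map_mem_testIdealCandidates {J : Ideal R} (hJ : J ∈ testIdealCandidates T a t) :
    J.map (algebraMap R S) ∈ testIdealCandidates (T.localize W S) (a.map (algebraMap R S)) t := by
  obtain ⟨hcomp, d, hdJ, hd⟩ := hJ
  refine ⟨?_, algebraMap R S d, Ideal.mem_map_of_mem _ hdJ, fun η hη h =>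
    hd _ ((mem_minimalPrimes_localization_iff W).mp hη) h⟩
  · rintro e ψ ⟨φ, hφ, w, hψ⟩ x hx
    rw [ceilPow_map, ← Ideal.map_mul, IsLocalization.mem_map_algebraMap_iff W] at hx
    obtain ⟨⟨⟨y, hy⟩, s⟩, hys⟩ := hx
    rw [hψ]
    refine Ideal.mul_mem_left _ _ ?_
    rw [← Ideal.unit_mul_mem_iff_mem _ (IsLocalization.map_units S s),
      localizeEnd_spec W S _ x ((s : R) ^ (p ^ e - 1) * y) s]
    · exact Ideal.mem_map_of_mem _ (hcomp e φ hφ _ (Ideal.mul_mem_left _ _ hy))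
    · rw [pow_eq_pow_sub_one_mul, map_mul, map_mul, ← hys]
      ring

theorem comap_mem_testIdealCandidates [IsReduced R] [IsNoetherianRing R] {K : Ideal S}
    (hK : K ∈ testIdealCandidates (T.localize W S) (a.map (algebraMap R S)) t) :
    K.comap (algebraMap R S) ∈ testIdealCandidates T a t := by
  obtain ⟨hcomp, z, hzK, hz⟩ := hK
  refine ⟨fun e φ hφ x hx => ?_, inter_circ_nonempty fun η hη hle => ?_⟩
  · rw [Ideal.mem_comap, ← localizeEnd_algebraMap W S (T.piece_le e hφ)]
    refine hcomp e _ (localizeEnd_mem_localize hφ) _ ?_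
    rw [ceilPow_map]
    have hx' := Ideal.mem_map_of_mem (algebraMap R S) hx
    rw [Ideal.map_mul] at hx'
    exact Ideal.mul_mono_right Ideal.map_comap_le hx'
  · have := hη.1.1
    -- If `η` misses `W`, it extends to a minimal prime of `S`, which `z ∈ K` avoids. Otherwise some
    -- `u ∉ η` annihilates an element of `W ∩ η`, so `u` dies in `S` and lies in the contraction.
    by_cases hW : Disjoint (W : Set R) η
    · obtain ⟨⟨x, s⟩, hxs⟩ := IsLocalization.surj W z
      have hxη : x ∈ η := hle (by
        rw [Ideal.mem_comap, ← hxs]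
        exact K.mul_mem_right _ hzK)
      have hmin : η.map (algebraMap R S) ∈ minimalPrimes S := by
        rw [mem_minimalPrimes_localization_iff W]
        have h1 := IsLocalization.under_map_of_isPrime_disjoint W S this hW
        rw [Ideal.under_def] at h1
        rw [h1]
        exact hη
      refine hz _ hmin ?_
      rw [← Ideal.mul_unit_mem_iff_mem _ (IsLocalization.map_units S s), hxs]
      exact Ideal.mem_map_of_mem _ hxη
    · obtain ⟨w, hw, hwη⟩ := Set.not_disjoint_iff.mp hW
      obtain ⟨u, hu, huw⟩ := exists_notMem_mul_eq_zero hη hwη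
      refine hu (hle ?_)
      have : algebraMap R S u = 0 :=
        (IsLocalization.map_eq_zero_iff W S u).mpr ⟨⟨w, hw⟩, by rw [mul_comm]; exact huw⟩
      rw [Ideal.mem_comap, this]
      exact K.zero_mem

theorem IsBigTestIdeal.map [IsReduced R] [IsNoetherianRing R] {J : Ideal R}
    (hJ : IsBigTestIdeal T a t J) :
    IsBigTestIdeal (T.localize W S) (a.map (algebraMap R S)) t (J.map (algebraMap R S)) :=
  ⟨map_mem_testIdealCandidates hJ.1, fun _ hK =>
    Ideal.map_le_iff_le_comap.mpr (hJ.2 (comap_mem_testIdealCandidates hK))⟩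

end Localization

/-! ### Trace ideals and strong `F`-regularity. -/

section TraceIdeal

variable {p : ℕ} {R : Type*} [CommRing R]

/-- The ideal `∑ φ (F^e_* 𝔞^⌈t(p^e-1)⌉ I)`, the sum running over `φ ∈ 𝒯_e`. -/
noncomputable def traceIdeal (T : GradedSubalgebra p R) (a : Ideal R) (t : ℝ) (e : ℕ)
    (I : Ideal R) : Ideal R :=
  Ideal.span {y | ∃ φ ∈ T.piece e, ∃ x ∈ ceilPow p a t e * I, φ x = y}

variable {T : GradedSubalgebra p R} {a : Ideal R} {t : ℝ}

theorem apply_mem_traceIdeal {e : ℕ} {I : Ideal R} {φ : AddMonoid.End R} (hφ : φ ∈ T.piece e)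
    {x : R} (hx : x ∈ ceilPow p a t e * I) : φ x ∈ traceIdeal T a t e I :=
  Ideal.subset_span ⟨φ, hφ, x, hx, rfl⟩

theorem traceIdeal_mono (e : ℕ) {I J : Ideal R} (h : I ≤ J) :
    traceIdeal T a t e I ≤ traceIdeal T a t e J :=
  Ideal.span_mono fun _ ⟨φ, hφ, x, hx, hy⟩ => ⟨φ, hφ, x, Ideal.mul_mono_right h hx, hy⟩

theorem ceilPow_zero : ceilPow p a t 0 = ⊤ := by
  simp [ceilPow]

theorem traceIdeal_zero (I : Ideal R) : traceIdeal T a t 0 I = I := by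
  refine le_antisymm (Ideal.span_le.mpr ?_) fun x hx => ?_
  · rintro _ ⟨φ, hφ, x, hx, rfl⟩
    rw [ceilPow_zero, Ideal.top_mul] at hx
    have h := T.piece_le 0 hφ x 1
    rw [pow_zero, pow_one, mul_one] at h
    rw [SetLike.mem_coe, h]
    exact I.mul_mem_right _ hx
  · have h1 : (1 : AddMonoid.End R) ∈ T.piece 0 := by
      rw [T.piece_zero]
      exact SetLike.GradedOne.one_mem
    exact apply_mem_traceIdeal h1 (by rwa [ceilPow_zero, Ideal.top_mul])

theorem pow_mul_mem_ceilPow_add {d e : ℕ} {u v : R} (hu : u ∈ ceilPow p a t d)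
    (hv : v ∈ ceilPow p a t e) : u ^ (p ^ e) * v ∈ ceilPow p a t (d + e) := by
  have h := Ideal.mul_mem_mul (Ideal.pow_mem_pow hu (p ^ e)) hv
  rw [ceilPow, ceilPow, ← pow_mul, ← pow_add] at h
  refine Ideal.pow_le_pow_right (Nat.ceil_le.mpr ?_) h
  push_cast
  have h1 := mul_le_mul_of_nonneg_right (Nat.le_ceil (t * ((p : ℝ) ^ d - 1)))
    (pow_nonneg (Nat.cast_nonneg p) e : (0 : ℝ) ≤ (p : ℝ) ^ e)
  have h2 := Nat.le_ceil (t * ((p : ℝ) ^ e - 1))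
  calc t * ((p : ℝ) ^ (d + e) - 1)
      = t * ((p : ℝ) ^ d - 1) * (p : ℝ) ^ e + t * ((p : ℝ) ^ e - 1) := by ring
    _ ≤ _ := add_le_add h1 h2

theorem traceIdeal_traceIdeal_le (d e : ℕ) (I : Ideal R) :
    traceIdeal T a t d (traceIdeal T a t e I) ≤ traceIdeal T a t (d + e) I := by
  refine Ideal.span_le.mpr ?_
  rintro _ ⟨φ, hφ, x, hx, rfl⟩
  refine Submodule.mul_induction_on hx (fun u hu v hv => ?_) fun x y hx hy => ?_
  · induction hv using Submodule.span_induction generalizing u with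
    | mem v hv =>
      obtain ⟨ψ, hψ, w, hw, rfl⟩ := hv
      rw [← T.piece_le e hψ]
      refine apply_mem_traceIdeal (T.mul_mem hφ hψ) ?_
      refine Submodule.mul_induction_on hw (fun b hb i hi => ?_) fun x y hx hy => ?_
      · rw [← mul_assoc]
        exact Ideal.mul_mem_mul (pow_mul_mem_ceilPow_add hu hb) hi
      · rw [mul_add]
        exact add_mem hx hy
    | zero => simp
    | add x y _ _ hx hy =>
      rw [mul_add, map_add]
      exact add_mem (hx u hu) (hy u hu)
    | smul s v _ hv =>
      rw [smul_eq_mul, ← mul_assoc]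
      exact hv _ (Ideal.mul_mem_right _ _ hu)
  · rw [map_add]
    exact add_mem hx hy

/-- If `r` lies in the first factor, then `r * φ x = φ (r ^ (p ^ e) * x)`, and `r ^ (p ^ e)` still
lies there. -/
theorem traceIdeal_mul_traceIdeal_top_le [Fact p.Prime] (e f : ℕ) (I : Ideal R) :
    traceIdeal T a t f I * traceIdeal T a t e ⊤ ≤ traceIdeal T a t (e + f) I := by
  refine le_trans ?_ (traceIdeal_traceIdeal_le e f I)
  refine Ideal.mul_le.mpr fun r hr v hv => ?_
  induction hv using Submodule.span_induction with
  | mem v hv =>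
    obtain ⟨φ, hφ, x, hx, rfl⟩ := hv
    rw [← T.piece_le e hφ, mul_comm]
    rw [Ideal.mul_top] at hx
    exact apply_mem_traceIdeal hφ (Ideal.mul_mem_mul hx (Ideal.pow_mem_of_mem _ hr _
      (pow_pos (Fact.out : p.Prime).pos e)))
  | zero => simp
  | add x y _ _ hx hy =>
    rw [mul_add]
    exact add_mem hx hy
  | smul s v _ hv =>
    rw [smul_eq_mul, mul_left_comm]
    exact Ideal.mul_mem_left _ _ hv

theorem traceIdeal_pow_le [Fact p.Prime] (e k : ℕ) (I : Ideal R) :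
    traceIdeal T a t e I ^ (k + 1) ≤ traceIdeal T a t ((k + 1) * e) I := by
  induction k with
  | zero => simp
  | succ k ih =>
    rw [pow_succ, show (k + 1 + 1) * e = e + (k + 1) * e by ring]
    exact (Ideal.mul_mono ih (traceIdeal_mono e le_top)).trans
      (traceIdeal_mul_traceIdeal_top_le e _ I)

theorem isCompatible_iSup_traceIdeal (I : Ideal R) :
    IsCompatible T a t (⨆ e, traceIdeal T a t e I) := fun d φ hφ x hx => by
  rw [Ideal.mul_iSup] at hx
  induction hx using Submodule.iSup_induction' with
  | mem e x hx =>
    exact Submodule.mem_iSup_of_mem (d + e)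
      (traceIdeal_traceIdeal_le d e I (apply_mem_traceIdeal hφ hx))
  | zero => simp
  | add x y _ _ hx hy =>
    rw [map_add]
    exact add_mem hx hy

/-- Finitely many degrees suffice for 1. In a common multiple of them, the trace ideal contains a
power of each of theirs, so a maximal ideal containing it would contain them all. The shift `e + 1`
keeps the common multiple positive. -/
theorem exists_traceIdeal_eq_top [Fact p.Prime] {I : Ideal R}
    (h : ⨆ e, traceIdeal T a t (e + 1) I = ⊤) : ∃ e, traceIdeal T a t e I = ⊤ := by
  obtain ⟨s, hs⟩ := Submodule.mem_iSup_iff_exists_finset.mp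
    (h ▸ Submodule.mem_top : (1 : R) ∈ ⨆ e, traceIdeal T a t (e + 1) I)
  refine ⟨∏ i ∈ s, (i + 1), ?_⟩
  by_contra hne
  obtain ⟨M, hM, hle⟩ := Ideal.exists_le_maximal _ hne
  refine hM.ne_top ((Ideal.eq_top_iff_one M).mpr ?_)
  refine (iSup₂_le fun i hi => ?_ : ⨆ i ∈ s, traceIdeal T a t (i + 1) I ≤ M) hs
  obtain ⟨k, hk⟩ := Finset.dvd_prod_of_mem (fun i => i + 1) hi
  have hk0 : k ≠ 0 := by
    rintro rfl
    exact (Finset.prod_pos fun i _ => Nat.succ_pos i).ne' hk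
  obtain ⟨k, rfl⟩ := Nat.exists_eq_succ_of_ne_zero hk0
  rw [hk, mul_comm] at hle
  exact hM.isPrime.le_of_pow_le ((traceIdeal_pow_le (i + 1) k I).trans hle)

theorem mulLeft_mul_mem_pieceMul {e : ℕ} {b : Ideal R} {φ : AddMonoid.End R}
    (hφ : φ ∈ T.pieceMul e b) (s : R) : AddMonoid.End.mulLeft s * φ ∈ T.pieceMul e b := by
  induction hφ using AddSubgroup.closure_induction with
  | mem φ hφ =>
    obtain ⟨φ, hφ, r, hr, rfl⟩ := hφ
    exact AddSubgroup.subset_closure ⟨_, T.mulLeft_mul_mem hφ s, r, hr, (mul_assoc _ _ _).symm⟩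
  | zero => rw [mul_zero]; exact zero_mem _
  | add φ ψ _ _ hφ hψ => rw [mul_add]; exact add_mem hφ hψ
  | neg φ _ hφ => rw [mul_neg]; exact neg_mem hφ

theorem exists_mem_pieceMul_of_mem_traceIdeal {e : ℕ} {d y : R}
    (hy : y ∈ traceIdeal T a t e (Ideal.span {d})) :
    ∃ φ ∈ T.pieceMul e (ceilPow p a t e), φ d = y := by
  induction hy using Submodule.span_induction with
  | mem y hy =>
    obtain ⟨φ, hφ, x, hx, rfl⟩ := hy
    obtain ⟨b, hb, rfl⟩ := Ideal.mem_mul_span_singleton.mp hx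
    exact ⟨_, AddSubgroup.subset_closure ⟨φ, hφ, b, hb, rfl⟩, rfl⟩
  | zero => exact ⟨0, zero_mem _, rfl⟩
  | add x y _ _ hx hy =>
    obtain ⟨φ, hφ, rfl⟩ := hx
    obtain ⟨ψ, hψ, rfl⟩ := hy
    exact ⟨φ + ψ, add_mem hφ hψ, rfl⟩
  | smul s v _ hv =>
    obtain ⟨φ, hφ, rfl⟩ := hv
    exact ⟨AddMonoid.End.mulLeft s * φ, mulLeft_mul_mem_pieceMul hφ s, rfl⟩

theorem IsCompatible.apply_mem {J : Ideal R} (hJ : IsCompatible T a t J) {e : ℕ}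
    {φ : AddMonoid.End R} (hφ : φ ∈ T.pieceMul e (ceilPow p a t e)) {x : R} (hx : x ∈ J) :
    φ x ∈ J := by
  induction hφ using AddSubgroup.closure_induction with
  | mem φ hφ =>
    obtain ⟨φ, hφ, r, hr, rfl⟩ := hφ
    exact hJ e φ hφ _ (Ideal.mul_mem_mul hr hx)
  | zero => exact J.zero_mem
  | add φ ψ _ _ hφ hψ => exact add_mem hφ hψ
  | neg φ _ hφ => exact neg_mem hφ

theorem IsStronglyFRegular.bigTestIdeal_eq_top (h : IsStronglyFRegular T a t) :
    bigTestIdeal T a t = ⊤ := by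
  refine sInf_eq_top.mpr fun J hJ => ?_
  obtain ⟨hJ, d, hdJ, hd⟩ := hJ
  obtain ⟨e, φ, hφ, x, hx, hφx⟩ := h d hd
  rw [Ideal.eq_top_iff_one, ← hφx]
  exact hJ.apply_mem hφ ((Ideal.span_singleton_le_iff_mem J).mpr hdJ hx)

theorem isStronglyFRegular_of_bigTestIdeal_eq_top [Fact p.Prime] [CharP R p] [IsReduced R]
    [IsNoetherianRing R] (hF : (frobenius R p).Finite) (hT : IsNondegenerate T a)
    (h : bigTestIdeal T a t = ⊤) : IsStronglyFRegular T a t := fun d hd => by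
  obtain ⟨e₀, he₀, φ, hφ, g, hg, c, hc, hcy⟩ := hT.exists_mul_mem_span hF t
  obtain ⟨r, hr⟩ := exists_apply_mul_eq (T.piece_le e₀ hφ) hcy
  have hc' : c ∈ traceIdeal T a t e₀ ⊤ := by
    rw [← hr]
    exact apply_mem_traceIdeal hφ (Ideal.mul_mem_mul hg Submodule.mem_top)
  have htop : ⨆ e, traceIdeal T a t e (Ideal.span {d * c}) = ⊤ := by
    refine sInf_eq_top.mp h _ ⟨isCompatible_iSup_traceIdeal _, d * c, ?_, mul_mem_circ hd hc⟩
    refine Submodule.mem_iSup_of_mem 0 ?_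
    rw [traceIdeal_zero]
    exact Ideal.mem_span_singleton_self _
  have hle : Ideal.span {d * c} ≤ Ideal.span {d} :=
    Ideal.span_singleton_le_span_singleton.mpr (dvd_mul_right d c)
  -- The factor `c` eliminates degree 0: as `c` lies in the degree `e₀` trace ideal of `R`, `d * c`
  -- lies in that of `dR`, and `e₀ > 0`.
  have htop' : ⨆ e, traceIdeal T a t (e + 1) (Ideal.span {d}) = ⊤ := by
    refine top_unique (htop ▸ iSup_le fun e => ?_)
    cases e with
    | zero =>
      obtain ⟨k, rfl⟩ := Nat.exists_eq_succ_of_ne_zero he₀.ne'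
      rw [traceIdeal_zero, Ideal.span_singleton_le_iff_mem]
      refine Submodule.mem_iSup_of_mem k ?_
      refine traceIdeal_mul_traceIdeal_top_le (k + 1) 0 _ (Ideal.mul_mem_mul ?_ hc')
      rw [traceIdeal_zero]
      exact Ideal.mem_span_singleton_self d
    | succ e =>
      exact (traceIdeal_mono _ hle).trans
        (le_iSup (fun e => traceIdeal T a t (e + 1) (Ideal.span {d})) e)
  obtain ⟨e, he⟩ := exists_traceIdeal_eq_top htop'
  obtain ⟨ψ, hψ, hψ'⟩ := exists_mem_pieceMul_of_mem_traceIdeal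
    (he ▸ Submodule.mem_top : (1 : R) ∈ traceIdeal T a t e (Ideal.span {d}))
  exact ⟨e, ψ, hψ, d, Ideal.mem_span_singleton_self d, hψ'⟩

end TraceIdeal

end CartierTest

/-! ### The proposition. -/

theorem mainTheorem9 (p : ℕ) [Fact p.Prime] (R : Type*) [CommRing R] [CharP R p]
    [IsNoetherianRing R] [IsReduced R] (hF : (frobenius R p).Finite)
    (T T' : CartierTest.GradedSubalgebra p R) (a : Ideal R) (t : ℝ) (ht : 0 < t)
    (hTT' : T' ≤ T)
    (hT : CartierTest.IsNondegenerate T a) (hT' : CartierTest.IsNondegenerate T' a) :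
    -- the test ideals exist
    CartierTest.IsBigTestIdeal T a t (CartierTest.bigTestIdeal T a t) ∧
    CartierTest.IsBigTestIdeal T' a t (CartierTest.bigTestIdeal T' a t) ∧
    -- (i)
    CartierTest.bigTestIdeal T' a t ≤ CartierTest.bigTestIdeal T a t ∧
    -- (ii)
    (∀ (W : Submonoid R) (S : Type*) [CommRing S] [Algebra R S] [IsLocalization W S],
      CartierTest.IsBigTestIdeal (T.localize W S) (a.map (algebraMap R S)) t
        (CartierTest.bigTestIdeal (T.localize W S) (a.map (algebraMap R S)) t) ∧
      (CartierTest.bigTestIdeal T a t).map (algebraMap R S) =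
        CartierTest.bigTestIdeal (T.localize W S) (a.map (algebraMap R S)) t) ∧
    -- (iii)
    (CartierTest.IsStronglyFRegular T a t ↔ CartierTest.bigTestIdeal T a t = ⊤) := by
  refine ⟨hT.isBigTestIdeal hF t, hT'.isBigTestIdeal hF t, ?_, ?_,
    fun h => h.bigTestIdeal_eq_top, CartierTest.isStronglyFRegular_of_bigTestIdeal_eq_top hF hT⟩
  · have h := (hT.isBigTestIdeal hF t).1
    exact sInf_le ⟨CartierTest.isCompatible_of_le hTT' h.1, h.2⟩
  · intro W S _ _ _
    have h := (hT.isBigTestIdeal hF t).map (W := W) (S := S)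
    exact ⟨h.eq_bigTestIdeal.symm ▸ h, h.eq_bigTestIdeal.symm⟩
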